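/- **Model.** Let $r\ge 2$. A sample of $N=n+m$ points in $\mathbb R^d$ consists of $n$ inliers ($\mathcal I$) and $m$ outliers ($\mathcal O$). The inliers are i.i.d. from a mixture of $r$ sub-gaussian distributions: each inlier $i$ receives a label $\phi_i\in\{1,\dots,r\}$ with $\mathbb P(\phi_i=k)=\pi_k$ (where $\pi_k\ge 0$, $\sum_k\pi_k=1$), and given $\phi_i=k$ the point $y_i$ is drawn from a distribution $\mathcal D_k$ with mean $\mu_k$ that is sub-gaussian with parameter $\sigma_k>0$, i.e. $\mathbb E\,e^{\nu^\top(y_i-\mu_k)}\le e^{\sigma_k^2\|\nu\|^2/2}$ for all $\nu\in\mathbb R^d$. The outliers are arbitrary random vectors, possibly dependent on the inliers. Put $\sigma_{\max}=\max_k\sigma_k$, $\Delta_{kl}=\|\mu_k-\mu_l\|_2$, $\Delta_{\min}=\min_{k\ne l}\Delta_{kl}$, $n_k=|\{i\in\mathcal I:\phi_i=k\}|$, $n_{\min}=\min_k n_k$. The true clustering matrix $X^0\in\{0,1\}^{N\times N}$ has $X^0_{ij}=1$ iff $i,j$ are inliers with the same label. For $\theta>0$ let $K_{ij}=\exp(-\|y_i-y_j\|^2/\theta^2)$,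 and for $\gamma\in(0,1)$ let $\hat X$ be any optimal solution of the linear program $$\max\ \sum_{i,j}(K_{ij}-\gamma)X_{ij}\quad\text{subject to } 0\le X_{ij}\le 1\ \ \forall i,j ,$$ for instance the rounded kernel matrix $\hat X_{ij}=\mathbf 1\{K_{ij}>\gamma\}$. Write $\|A\|_1=\sum_{i,j}|A_{ij}|$, and $A_{\mathcal I}$ for the restriction of $A$ to inlier rows and columns. **Theorem (estimation error for the Robust-LP solution).** There are universal constants $C,C',C''>0$ such that the following holds. Let $$\tau_{\rm in}=\exp\Big(-\frac{5\Delta_{\min}^2}{32\theta^2}\Big),\qquad \tau_{\rm out}=\max_{k\ne l}\exp\Big(-\frac{\Delta_{kl}^2}{2\theta^2}\Big)=\exp\Big(-\frac{\Delta_{\min}^2}{2\theta^2}\Big),$$ let $\gamma\in(\tau_{\rm out},\tau_{\rm in})$, let $\theta=\Theta(\Delta_{\min})$, that is, $\kappa_1\Delta_{\min}\le\theta\le\kappa_2\Delta_{\min}$ for some $\kappa_1,\kappa_2>0$ (on which $C,C',C''$ do not depend), and suppose $\Delta_{\min}\ge 8\sigma_{\max}\sqrt d$. Then, conditionally on any labels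 $(\phi_i)_{i\in\mathcal I}$ of positive probability with $n_{\min}>r$, with probability at least $1-2r/n_{\min}$ every such $\hat X$ satisfies $$\|\hat X_{\mathcal I}-X^0_{\mathcal I}\|_1\le C n^2\max\Big\{\exp\Big(-\frac{\Delta_{\min}^2}{64\sigma_{\max}^2}\Big),\frac{\log n_{\min}}{n_{\min}}\Big\}$$ and, if $m<n$, on the same event also $$\frac{\|\hat X-X^0\|_1}{\|X^0\|_1}\le C' r\exp\Big(-\frac{\Delta_{\min}^2}{64\sigma_{\max}^2}\Big)+C'' r\max\Big\{\frac{\log n_{\min}}{n_{\min}},\frac mn\Big\}.$$ -/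

import Mathlib

open MeasureTheory ProbabilityTheory

namespace RobustClustering

noncomputable section

/-- A probability measure `D` on `ℝ^d` is sub-gaussian with mean `c` and sub-gaussian
parameter `ψ` if its mean is `c` and `E exp ⟨ν, X - c⟩ ≤ exp (ψ² ‖ν‖² / 2)` for every `ν`
(the expectation being finite). -/
structure IsSubgaussianVector {d : ℕ} (D : Measure (EuclideanSpace ℝ (Fin d)))
    (c : EuclideanSpace ℝ (Fin d)) (ψ : ℝ) : Prop where
  mean_eq : ∫ x, x ∂D = c
  integrable_exp : ∀ ν : EuclideanSpace ℝ (Fin d),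
    Integrable (fun x => Real.exp (inner ℝ ν (x - c))) D
  mgf_le : ∀ ν : EuclideanSpace ℝ (Fin d),
    ∫ x, Real.exp (inner ℝ ν (x - c)) ∂D ≤ Real.exp (ψ ^ 2 * ‖ν‖ ^ 2 / 2)

/-- The mixture model with `n` inliers (indices `Sum.inl i`) and `m` outliers (indices
`Sum.inr j`). The pairs (label, point) of the inliers are independent and identically
distributed: the label of an inlier is `k` with probability `w k`, and given the label `k` the
point is distributed as `D k`. The outliers are arbitrary random vectors; they may depend on the
inliers, on the labels, and on one another. -/
structure IsMixtureSample {Ω : Type*} [MeasurableSpace Ω] (P : Measure Ω) {d r n m : ℕ}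
    (w : Fin r → ℝ) (D : Fin r → Measure (EuclideanSpace ℝ (Fin d)))
    (φ : Fin n → Ω → Fin r) (y : Fin n ⊕ Fin m → Ω → EuclideanSpace ℝ (Fin d)) : Prop where
  weight_nonneg : ∀ k, 0 ≤ w k
  weight_sum : ∑ k, w k = 1
  measurable_label : ∀ i, Measurable (φ i)
  measurable_point : ∀ a, Measurable (y a)
  indep : iIndepFun (fun (i : Fin n) (ω : Ω) => (φ i ω, y (Sum.inl i) ω)) P
  law : ∀ (i : Fin n) (k : Fin r) (B : Set (EuclideanSpace ℝ (Fin d))), MeasurableSet B →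
    P {ω | φ i ω = k ∧ y (Sum.inl i) ω ∈ B} = ENNReal.ofReal (w k) * D k B

/-- The minimum separation `min_{k ≠ l} ‖μ_k - μ_l‖` of the cluster centers (for `r ≥ 2`). -/
def minSeparation {d r : ℕ} (μ : Fin r → EuclideanSpace ℝ (Fin d)) : ℝ :=
  ⨅ p : {p : Fin r × Fin r // p.1 ≠ p.2}, ‖μ p.1.1 - μ p.1.2‖

/-- `max_k σ_k`. -/
def sigmaMax {r : ℕ} (σ : Fin r → ℝ) : ℝ := ⨆ k, σ k

/-- `n_k`, the number of inliers with label `k`. -/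
def clusterSize {r n : ℕ} (lab : Fin n → Fin r) (k : Fin r) : ℕ :=
  (Finset.univ.filter (fun i => lab i = k)).card

/-- `n_min = min_k n_k`. -/
def minClusterSize {r n : ℕ} (lab : Fin n → Fin r) : ℕ := ⨅ k, clusterSize lab k

/-- The true membership matrix `Z⁰`; the rows of the outliers vanish. -/
def membership {r n : ℕ} (m : ℕ) (lab : Fin n → Fin r) : Matrix (Fin n ⊕ Fin m) (Fin r) ℝ :=
  Matrix.of fun a k => Sum.elim (fun i => if lab i = k then 1 else 0) (fun _ => 0) a

/-- The true clustering matrix `X⁰ = Z⁰ (Z⁰)ᵀ`. -/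
def trueClustering {r n : ℕ} (m : ℕ) (lab : Fin n → Fin r) :
    Matrix (Fin n ⊕ Fin m) (Fin n ⊕ Fin m) ℝ :=
  membership m lab * (membership m lab).transpose

/-- The Gaussian kernel matrix `K_ij = exp (-‖y_i - y_j‖² / θ²)`. -/
def kernelMatrix {d : ℕ} {ι : Type*} (θ : ℝ) (y : ι → EuclideanSpace ℝ (Fin d)) : Matrix ι ι ℝ :=
  Matrix.of fun i j => Real.exp (-(‖y i - y j‖ ^ 2 / θ ^ 2))

/-- The entrywise `ℓ₁` norm. -/
def l1Norm {ι : Type*} [Fintype ι] (A : Matrix ι ι ℝ) : ℝ := ∑ i, ∑ j, |A i j|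

/-- The restriction of a matrix to the inliers. -/
def inlierPart {n m : ℕ} (A : Matrix (Fin n ⊕ Fin m) (Fin n ⊕ Fin m) ℝ) :
    Matrix (Fin n) (Fin n) ℝ :=
  A.submatrix Sum.inl Sum.inl

/-- The feasible set of the linear program: `0 ≤ X_ij ≤ 1`. -/
def robustLPFeasible (ι : Type*) : Set (Matrix ι ι ℝ) :=
  {X | ∀ i j, 0 ≤ X i j ∧ X i j ≤ 1}

/-- The objective `⟨K - γ E, X⟩`, with `E` the all-ones matrix. -/
def robustLPObjective {ι : Type*} [Fintype ι] (K : Matrix ι ι ℝ) (γ : ℝ) (X : Matrix ι ι ℝ) : ℝ :=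
  ∑ i, ∑ j, (K i j - γ) * X i j

/-- `X` is an optimal solution of the linear program
`maximize ⟨K - γ E, X⟩ subject to 0 ≤ X_ij ≤ 1`. -/
def IsRobustLPSolution {ι : Type*} [Fintype ι] (K : Matrix ι ι ℝ) (γ : ℝ) (X : Matrix ι ι ℝ) :
    Prop :=
  X ∈ robustLPFeasible ι ∧ IsMaxOn (robustLPObjective K γ) (robustLPFeasible ι) X

/-- The rounded kernel matrix: `1` where `K_ij > γ` and `0` elsewhere. -/
def roundedKernel {ι : Type*} (K : Matrix ι ι ℝ) (γ : ℝ) : Matrix ι ι ℝ :=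
  Matrix.of fun i j => if γ < K i j then 1 else 0

/-- The rounded kernel matrix is an optimal solution of the linear program. -/
theorem roundedKernel_isRobustLPSolution {ι : Type*} [Fintype ι] (K : Matrix ι ι ℝ) (γ : ℝ) :
    IsRobustLPSolution K γ (roundedKernel K γ) := by
  constructor
  · intro i j
    by_cases h : γ < K i j <;> simp [roundedKernel, h]
  · intro X hX
    change (∑ i, ∑ j, (K i j - γ) * X i j) ≤ ∑ i, ∑ j, (K i j - γ) * roundedKernel K γ i j
    refine Finset.sum_le_sum fun i _ => Finset.sum_le_sum fun j _ => ?_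
    obtain ⟨h0, h1⟩ := hX i j
    by_cases h : γ < K i j
    · simp only [roundedKernel, Matrix.of_apply, h, if_true]
      nlinarith
    · simp only [roundedKernel, Matrix.of_apply, h, if_false]
      nlinarith [not_lt.mp h]

/-- The upper threshold `τ_in = exp (-5 Δ² / (32 θ²))`, where `Δ` is the minimum separation. -/
def tauIn (Δ θ : ℝ) : ℝ := Real.exp (-(5 * Δ ^ 2 / (32 * θ ^ 2)))

/-- The lower threshold
`τ_out = max_{k ≠ l} exp (-‖μ_k - μ_l‖² / (2 θ²)) = exp (-Δ² / (2 θ²))`, where `Δ` is the minimum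
separation. -/
def tauOut (Δ θ : ℝ) : ℝ := Real.exp (-(Δ ^ 2 / (2 * θ ^ 2)))

end

end RobustClustering

/-! The linear program separates over entries: wherever `K i j ≠ γ`, an optimal `X` must equal the
rounded kernel. Since `γ` lies strictly between the two thresholds, `X` agrees with the true
clustering on every inlier pair outside `badPairs`, so the inlier error is at most twice the number
of bad pairs `i < j`.

Given the labels, the inliers are independent with laws `D (lab i)`. The centred difference of two
inliers is sub-gaussian with variance proxy `2 * σmax ^ 2`. A tail bound for its squared norm (equal
labels) and a one-dimensional Chernoff bound along the difference of the means (distinct labels)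
both give `p = exp (-Δ ^ 2 / (64 * σmax ^ 2))` as a bound on the probability that a pair is bad
(`measure_badPairs_le`).

Indicators of different pairs are dependent. Grouping the pairs by `i + j` modulo `n` splits them
into `n` matchings; within a matching the indicators are independent, and Jensen's inequality for
`exp` averages over the matchings (`measure_pairCount_ge_le`). Outliers add at most `2nm + m ^ 2` to
the error, and Cauchy-Schwarz over cluster sizes bounds the norm of the true clustering below by `n
^ 2 / r`. -/

namespace RobustClustering

/-! ### Tail bounds for sub-gaussian vectors. -/

section Tails

variable {d : ℕ}

theorem lintegral_exp_neg_mul_sq_norm {b : ℝ} (hb : 0 < b) :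
    ∫⁻ v : EuclideanSpace ℝ (Fin d), ENNReal.ofReal (Real.exp (-b * ‖v‖ ^ 2)) =
      ENNReal.ofReal ((Real.pi / b) ^ ((d : ℝ) / 2)) := by
  have h := GaussianFourier.integral_rexp_neg_mul_sq_norm
    (V := EuclideanSpace ℝ (Fin d)) hb
  have hne : (∫ v : EuclideanSpace ℝ (Fin d), Real.exp (-b * ‖v‖ ^ 2)) ≠ 0 := by
    rw [h]; positivity
  have hint : Integrable (fun v : EuclideanSpace ℝ (Fin d) => Real.exp (-b * ‖v‖ ^ 2)) := by
    -- A non-integrable function has integral `0` by convention, so a nonzero value proves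
    -- integrability.
    by_contra hcon
    exact hne (integral_undef hcon)
  rw [← ofReal_integral_eq_lintegral_ofReal hint
    (Filter.Eventually.of_forall fun v => (Real.exp_pos _).le), h]
  simp

theorem lintegral_exp_neg_mul_sq_norm_add_inner {b : ℝ} (hb : 0 < b)
    (w : EuclideanSpace ℝ (Fin d)) :
    ∫⁻ v : EuclideanSpace ℝ (Fin d), ENNReal.ofReal (Real.exp (-b * ‖v‖ ^ 2 + inner ℝ v w)) =
      ENNReal.ofReal ((Real.pi / b) ^ ((d : ℝ) / 2)) *
        ENNReal.ofReal (Real.exp (‖w‖ ^ 2 / (4 * b))) := by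
  -- Completing the square: the translation by `w / (2b)` removes the linear term.
  rw [← lintegral_exp_neg_mul_sq_norm hb,
    ← lintegral_add_right_eq_self _ ((1 / (2 * b)) • w), ← lintegral_mul_const _ (by fun_prop)]
  refine lintegral_congr fun v => ?_
  rw [← ENNReal.ofReal_mul (Real.exp_pos _).le, ← Real.exp_add, norm_add_sq_real, norm_smul,
    inner_smul_right, inner_add_left, real_inner_smul_left, real_inner_self_eq_norm_sq, mul_pow,
    Real.norm_eq_abs, sq_abs]
  congr 2
  field_simp
  ring

variable {Ω : Type*} [MeasurableSpace Ω] {Q : Measure Ω}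
  {Z : Ω → EuclideanSpace ℝ (Fin d)}

/-- Gaussian averaging: `exp (‖Z‖ ^ 2 / (4b))` is, up to a constant, the integral over `u` of `exp
(-b‖u‖ ^ 2 + ⟨u, Z⟩)`. After Tonelli the moment bound applies for each `u`. With `b = 2v/3` the
remaining exponent is `-2v/3 + v/2 = -v/6`, and the two Gaussian integrals have ratio `4 ^ (d/2) = 2
^ d`. -/
theorem lintegral_exp_sq_norm_le_of_subgaussian [SFinite Q] (hZ : Measurable Z) {v : ℝ} (hv : 0 < v)
    (hmgf : ∀ ν : EuclideanSpace ℝ (Fin d),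
      ∫⁻ ω, ENNReal.ofReal (Real.exp (inner ℝ ν (Z ω))) ∂Q ≤
        ENNReal.ofReal (Real.exp (v * ‖ν‖ ^ 2 / 2))) :
    ∫⁻ ω, ENNReal.ofReal (Real.exp (3 / (8 * v) * ‖Z ω‖ ^ 2)) ∂Q ≤ ENNReal.ofReal (2 ^ d) := by
  have hb : 0 < 2 * v / 3 := by positivity
  have hb' : 0 < v / 6 := by positivity
  set G : ENNReal := ENNReal.ofReal ((Real.pi / (2 * v / 3)) ^ ((d : ℝ) / 2)) with hG
  have hG0 : G ≠ 0 := by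
    have : 0 < (Real.pi / (2 * v / 3)) ^ ((d : ℝ) / 2) := by positivity
    simpa [hG] using this
  have hGt : G ≠ ⊤ := ENNReal.ofReal_ne_top
  have hratio : ENNReal.ofReal ((Real.pi / (v / 6)) ^ ((d : ℝ) / 2)) =
      G * ENNReal.ofReal (2 ^ d) := by
    rw [hG, ← ENNReal.ofReal_mul (by positivity)]
    congr 1
    have h1 : Real.pi / (v / 6) = Real.pi / (2 * v / 3) * 2 ^ (2 : ℝ) := by
      norm_num
      field_simp
      norm_num
    rw [h1, Real.mul_rpow (by positivity) (by positivity), ← Real.rpow_mul (by norm_num),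
      mul_div_cancel₀ _ (two_ne_zero' ℝ), Real.rpow_natCast]
  rw [← ENNReal.mul_le_mul_iff_right hG0 hGt, ← hratio, ← lintegral_const_mul _ (by fun_prop)]
  calc ∫⁻ ω, G * ENNReal.ofReal (Real.exp (3 / (8 * v) * ‖Z ω‖ ^ 2)) ∂Q
      = ∫⁻ ω, ∫⁻ u : EuclideanSpace ℝ (Fin d),
          ENNReal.ofReal (Real.exp (-(2 * v / 3) * ‖u‖ ^ 2 + inner ℝ u (Z ω))) ∂volume ∂Q := by
        refine lintegral_congr fun ω => ?_
        rw [lintegral_exp_neg_mul_sq_norm_add_inner hb, hG]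
        congr 3
        field_simp
        ring
    _ = ∫⁻ u : EuclideanSpace ℝ (Fin d), ∫⁻ ω,
          ENNReal.ofReal (Real.exp (-(2 * v / 3) * ‖u‖ ^ 2 + inner ℝ u (Z ω))) ∂Q := by
        refine lintegral_lintegral_swap (Measurable.aemeasurable ?_)
        unfold Function.uncurry
        fun_prop
    _ ≤ ∫⁻ u : EuclideanSpace ℝ (Fin d), ENNReal.ofReal (Real.exp (-(v / 6) * ‖u‖ ^ 2)) := by
        refine lintegral_mono fun u => ?_
        simp_rw [Real.exp_add, ENNReal.ofReal_mul (Real.exp_pos _).le]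
        rw [lintegral_const_mul _ (by fun_prop)]
        refine (mul_le_mul_right (hmgf u) _).trans (le_of_eq ?_)
        rw [← ENNReal.ofReal_mul (Real.exp_pos _).le, ← Real.exp_add]
        congr 2
        ring
    _ = ENNReal.ofReal ((Real.pi / (v / 6)) ^ ((d : ℝ) / 2)) := lintegral_exp_neg_mul_sq_norm hb'

theorem measure_le_of_lintegral_exp_le {f : Ω → ℝ} (hf : Measurable f) {a c : ℝ}
    (h : ∫⁻ ω, ENNReal.ofReal (Real.exp (f ω)) ∂Q ≤ ENNReal.ofReal (Real.exp c)) :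
    Q {ω | a ≤ f ω} ≤ ENNReal.ofReal (Real.exp (c - a)) := by
  have h1 := mul_meas_ge_le_lintegral (μ := Q)
    (f := fun ω => ENNReal.ofReal (Real.exp (f ω))) (by fun_prop) (ENNReal.ofReal (Real.exp a))
  have h2 : {ω | ENNReal.ofReal (Real.exp a) ≤ ENNReal.ofReal (Real.exp (f ω))} =
      {ω | a ≤ f ω} := by
    ext ω
    simp [ENNReal.ofReal_le_ofReal_iff (Real.exp_pos _).le]
  rw [h2] at h1
  have ha : ENNReal.ofReal (Real.exp a) ≠ 0 := by simpa using Real.exp_pos a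
  rw [← ENNReal.mul_le_mul_iff_right ha ENNReal.ofReal_ne_top,
    ← ENNReal.ofReal_mul (Real.exp_pos _).le, ← Real.exp_add, add_sub_cancel]
  exact h1.trans h

theorem measure_sq_norm_ge_le_of_subgaussian [SFinite Q] (hZ : Measurable Z) {v s : ℝ} (hv : 0 < v)
    (hmgf : ∀ ν : EuclideanSpace ℝ (Fin d),
      ∫⁻ ω, ENNReal.ofReal (Real.exp (inner ℝ ν (Z ω))) ∂Q ≤
        ENNReal.ofReal (Real.exp (v * ‖ν‖ ^ 2 / 2)))
    (hs : (d : ℝ) ≤ s) :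
    Q {ω | 5 * v * s ≤ ‖Z ω‖ ^ 2} ≤ ENNReal.ofReal (Real.exp (-s)) := by
  have hs0 : 0 ≤ s := le_trans (Nat.cast_nonneg d) hs
  have h1 := lintegral_exp_sq_norm_le_of_subgaussian hZ hv hmgf
  -- As `log 2 < 7/8` and `d ≤ s`, the dimensional factor costs at most `7s/8` of the Markov
  -- exponent `15s/8`, leaving `s`.
  have h2 : (2 : ℝ) ^ d ≤ Real.exp (7 / 8 * s) := by
    have h3 : (2 : ℝ) ≤ Real.exp (7 / 8) := by
      rw [← Real.log_le_iff_le_exp (by norm_num)]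
      linarith [Real.log_two_lt_d9]
    calc (2 : ℝ) ^ d ≤ Real.exp (7 / 8) ^ d := by gcongr
      _ = Real.exp (d * (7 / 8)) := by rw [← Real.exp_nat_mul]
      _ ≤ _ := Real.exp_le_exp.2 (by linarith)
  have h4 := measure_le_of_lintegral_exp_le (a := 15 / 8 * s) (by fun_prop)
    (h1.trans (ENNReal.ofReal_le_ofReal h2))
  refine (measure_mono fun ω hω => ?_).trans (h4.trans (ENNReal.ofReal_le_ofReal
    (Real.exp_le_exp.2 (by linarith))))
  simp only [Set.mem_ofPred_eq] at hω ⊢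
  calc 15 / 8 * s = 3 / (8 * v) * (5 * v * s) := by field_simp; ring
    _ ≤ _ := by gcongr

theorem measure_inner_le_le_of_subgaussian (hZ : Measurable Z) {v : ℝ} (hv : 0 < v)
    (hmgf : ∀ ν : EuclideanSpace ℝ (Fin d),
      ∫⁻ ω, ENNReal.ofReal (Real.exp (inner ℝ ν (Z ω))) ∂Q ≤
        ENNReal.ofReal (Real.exp (v * ‖ν‖ ^ 2 / 2)))
    (u : EuclideanSpace ℝ (Fin d)) :
    Q {ω | inner ℝ u (Z ω) ≤ -(‖u‖ ^ 2 / 4)} ≤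
      ENNReal.ofReal (Real.exp (-(‖u‖ ^ 2 / (32 * v)))) := by
  -- The factor `1/(4v)` minimises the Chernoff exponent `v t ^ 2 ‖u‖ ^ 2 / 2 - t ‖u‖ ^ 2 / 4`.
  have h1 := hmgf (-(1 / (4 * v)) • u)
  have h2 := measure_le_of_lintegral_exp_le (a := ‖u‖ ^ 2 / (16 * v)) (by fun_prop) h1
  refine (measure_mono fun ω hω => ?_).trans (h2.trans (le_of_eq ?_))
  · simp only [Set.mem_ofPred_eq, real_inner_smul_left] at hω ⊢
    have : ‖u‖ ^ 2 / (16 * v) = 1 / (4 * v) * (‖u‖ ^ 2 / 4) := by field_simp; norm_num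
    rw [this, neg_mul, ← mul_neg]
    have : 0 < 1 / (4 * v) := by positivity
    gcongr
    linarith
  · rw [norm_smul, mul_pow, Real.norm_eq_abs, sq_abs]
    congr 2
    field_simp
    ring

end Tails

/-! ### Counting dependent pairs through matchings. -/

section Matchings

variable {Ω E ι : Type*} [MeasurableSpace Ω] [MeasurableSpace E] {Q : Measure Ω}
  {Y : ι → Ω → E}

/-- The sets `{i, τ i}` for distinct `i ∈ T` are disjoint, so the factors depend on disjoint blocks
of independent variables; induction splits them off one by one. -/
theorem lintegral_prod_matching [DecidableEq ι] (hY : ∀ i, Measurable (Y i)) (hind : iIndepFun Y Q)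
    (τ : ι → ι) (F : ι → E × E → ENNReal) (hF : ∀ i, Measurable (F i)) (T : Finset ι)
    (hT : ∀ i ∈ T, ∀ j ∈ T, i ≠ j → i ≠ τ j ∧ τ i ≠ τ j) :
    ∫⁻ ω, ∏ i ∈ T, F i (Y i ω, Y (τ i) ω) ∂Q =
      ∏ i ∈ T, ∫⁻ ω, F i (Y i ω, Y (τ i) ω) ∂Q := by
  have := hind.isProbabilityMeasure
  induction T using Finset.induction_on with
  | empty => simp
  | insert a T ha ih =>
    have hne : ∀ j ∈ T, a ≠ j := fun j hj h => ha (h ▸ hj)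
    simp_rw [Finset.prod_insert ha]
    rw [← ih fun i hi j hj => hT i (by simp [hi]) j (by simp [hj])]
    refine lintegral_mul_eq_lintegral_mul_lintegral_of_indepFun'' ?_ ?_ ?_
    · exact ((hF a).comp ((hY a).prodMk (hY (τ a)))).aemeasurable
    · exact Finset.aemeasurable_fun_prod _ fun i _ =>
        ((hF i).comp ((hY i).prodMk (hY (τ i)))).aemeasurable
    · have hdisj : Disjoint ({a, τ a} : Finset ι) (T ∪ T.image τ) := by
        rw [Finset.disjoint_left]
        intro x hx hx'
        simp only [Finset.mem_insert, Finset.mem_singleton, Finset.mem_union,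
          Finset.mem_image] at hx hx'
        have key := fun j hj => hT a (by simp) j (Finset.mem_insert_of_mem hj) (hne j hj)
        have key' := fun j hj => hT j (Finset.mem_insert_of_mem hj) a (by simp) (hne j hj).symm
        grind
      have h := hind.indepFun_finset _ _ hdisj hY
      have hmem : ∀ i : {i // i ∈ T}, i.1 ∈ T ∪ T.image τ ∧ τ i.1 ∈ T ∪ T.image τ := fun i =>
        ⟨Finset.mem_union_left _ i.2, Finset.mem_union_right _ (Finset.mem_image_of_mem _ i.2)⟩
      have h2 := h.comp
        (φ := fun z => F a (z ⟨a, by simp⟩, z ⟨τ a, by simp⟩))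
        (ψ := fun z => ∏ i ∈ T.attach, F i.1 (z ⟨i.1, (hmem i).1⟩, z ⟨τ i.1, (hmem i).2⟩))
        ((hF a).comp ((measurable_pi_apply _).prodMk (measurable_pi_apply _)))
        (Finset.measurable_fun_prod _ fun i _ => (hF i.1).comp
          ((measurable_pi_apply _).prodMk (measurable_pi_apply _)))
      convert! h2 using 1
      ext ω
      exact (Finset.prod_attach T fun i => F i (Y i ω, Y (τ i) ω)).symm

open Classical in
/-- The number of pairs `i < j` for which `(x i, x j)` lies in `A i j`, grouped according to the
value of `i + j` modulo `n`. -/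
noncomputable def pairCount {n : ℕ} [NeZero n] (A : Fin n → Fin n → Set (E × E)) (x : Fin n → E) :
    ℝ :=
  ∑ s : Fin n, ∑ i with i < s - i, if (x i, x (s - i)) ∈ A i (s - i) then (1 : ℝ) else 0

variable {n : ℕ} [NeZero n] {Y : Fin n → Ω → E}

-- For fixed `s` the map `i ↦ s - i` is an involution, and keeping only `i < s - i` takes each pair
-- once, so the pairs form a matching. Each of its at most `n` factors has mean at most `1 + 2p ≤
-- exp (2p)`, because `e ≤ 3`.
open Classical in
theorem lintegral_exp_matching_le (hY : ∀ i, Measurable (Y i)) (hind : iIndepFun Y Q)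
    {A : Fin n → Fin n → Set (E × E)} (hA : ∀ i j, MeasurableSet (A i j)) {p : ℝ}
    (hp : ∀ i j, i ≠ j → Q {ω | (Y i ω, Y j ω) ∈ A i j} ≤ ENNReal.ofReal p) (hp0 : 0 ≤ p)
    (s : Fin n) :
    ∫⁻ ω, ENNReal.ofReal (Real.exp
        (∑ i with i < s - i, if (Y i ω, Y (s - i) ω) ∈ A i (s - i) then (1 : ℝ) else 0)) ∂Q ≤
      ENNReal.ofReal (Real.exp (2 * n * p)) := by
  have := hind.isProbabilityMeasure
  have hmeas : ∀ i, Measurable fun z : E × E =>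
      ENNReal.ofReal (Real.exp (if z ∈ A i (s - i) then (1 : ℝ) else 0)) := fun i =>
    ENNReal.measurable_ofReal.comp (Real.measurable_exp.comp
      (Measurable.ite (hA _ _) measurable_const measurable_const))
  have h1 := lintegral_prod_matching hY hind (fun i => s - i) _ hmeas
    (Finset.univ.filter fun i => i < s - i) (by
      intro i hi j hj hij
      simp only [Finset.mem_filter, Finset.mem_univ, true_and] at hi hj
      refine ⟨fun h => ?_, fun h => hij (sub_right_injective h)⟩
      subst h
      rw [sub_sub_cancel] at hi
      exact lt_asymm hi hj)
  simp_rw [Real.exp_sum, ENNReal.ofReal_prod_of_nonneg fun i _ => (Real.exp_pos _).le]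
  rw [h1]
  have h2 : ∀ i ∈ Finset.univ.filter (fun i : Fin n => i < s - i),
      ∫⁻ ω, ENNReal.ofReal (Real.exp
        (if (Y i ω, Y (s - i) ω) ∈ A i (s - i) then (1 : ℝ) else 0)) ∂Q ≤
        ENNReal.ofReal (Real.exp (2 * p)) := by
    intro i hi
    have hlt : i < s - i := by simpa using hi
    set B := {ω | (Y i ω, Y (s - i) ω) ∈ A i (s - i)} with hB
    have hBm : MeasurableSet B := ((hY i).prodMk (hY (s - i))) (hA _ _)
    calc _ ≤ ∫⁻ ω, (1 + B.indicator (fun _ => 2) ω) ∂Q := by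
          refine lintegral_mono fun ω => ?_
          by_cases h : (Y i ω, Y (s - i) ω) ∈ A i (s - i)
          · have hω : ω ∈ B := h
            simp only [h, if_true, Set.indicator_of_mem hω]
            refine ENNReal.ofReal_le_of_le_toReal ?_
            rw [ENNReal.toReal_add (by simp) (by simp)]
            norm_num
            linarith [Real.exp_one_lt_d9]
          · simp [h]
      _ = 1 + 2 * Q B := by
          rw [lintegral_add_left measurable_const, lintegral_indicator_const hBm]
          simp
      _ ≤ 1 + 2 * ENNReal.ofReal p := by gcongr; exact hp i _ hlt.ne
      _ = ENNReal.ofReal (1 + 2 * p) := by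
          rw [ENNReal.ofReal_add zero_le_one (by positivity), ENNReal.ofReal_mul zero_le_two]
          simp
      _ ≤ _ := ENNReal.ofReal_le_ofReal (by linarith [Real.add_one_le_exp (2 * p)])
  refine (Finset.prod_le_pow_card _ _ _ h2).trans ?_
  rw [← ENNReal.ofReal_pow (Real.exp_pos _).le, ← Real.exp_nat_mul]
  refine ENNReal.ofReal_le_ofReal (Real.exp_le_exp.2 ?_)
  have hc : ((Finset.univ.filter fun i : Fin n => i < s - i).card : ℝ) ≤ n := by
    exact_mod_cast (Finset.card_filter_le _ _).trans (by simp)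
  nlinarith

theorem measurable_pairCount (hY : ∀ i, Measurable (Y i)) {A : Fin n → Fin n → Set (E × E)}
    (hA : ∀ i j, MeasurableSet (A i j)) :
    Measurable fun ω => pairCount A fun i => Y i ω := by
  unfold pairCount
  exact Finset.measurable_fun_sum _ fun s _ => Finset.measurable_fun_sum _ fun i _ =>
    Measurable.ite (((hY i).prodMk (hY (s - i))) (hA _ _)) measurable_const measurable_const

/-- The count divided by `n` is the mean of the `n` matching counts, so convexity of `exp` transfers
the exponential moment of one matching to it; Markov's inequality then gives the tail. -/
theorem measure_pairCount_ge_le (hY : ∀ i, Measurable (Y i)) (hind : iIndepFun Y Q)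
    {A : Fin n → Fin n → Set (E × E)} (hA : ∀ i j, MeasurableSet (A i j)) {p : ℝ}
    (hp : ∀ i j, i ≠ j → Q {ω | (Y i ω, Y j ω) ∈ A i j} ≤ ENNReal.ofReal p) (hp0 : 0 ≤ p)
    (x : ℝ) :
    Q {ω | (n : ℝ) ^ 2 * x ≤ pairCount A fun i => Y i ω} ≤
      ENNReal.ofReal (Real.exp (2 * n * p - n * x)) := by
  classical
  have hn : (0 : ℝ) < n := by exact_mod_cast NeZero.pos n
  have h1 : ∫⁻ ω, ENNReal.ofReal (Real.exp ((pairCount A fun i => Y i ω) / n)) ∂Q ≤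
      ENNReal.ofReal (Real.exp (2 * n * p)) := by
    have hj : ∀ ω, Real.exp ((pairCount A fun i => Y i ω) / n) ≤
        ∑ s : Fin n, (1 / (n : ℝ)) * Real.exp (∑ i with i < s - i,
          if (Y i ω, Y (s - i) ω) ∈ A i (s - i) then (1 : ℝ) else 0) := by
      intro ω
      have h := convexOn_exp.map_sum_le (t := Finset.univ) (w := fun _ : Fin n => 1 / (n : ℝ))
        (p := fun s : Fin n => ∑ i with i < s - i,
          if (Y i ω, Y (s - i) ω) ∈ A i (s - i) then (1 : ℝ) else 0)
        (fun _ _ => by positivity) (by simp [hn.ne']) (fun _ _ => Set.mem_univ _)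
      simp only [smul_eq_mul] at h
      refine le_trans (le_of_eq ?_) h
      rw [← Finset.mul_sum, pairCount]
      congr 1
      rw [div_eq_mul_one_div, mul_comm]
    have hm : ∀ s : Fin n, Measurable fun ω => Real.exp (∑ i with i < s - i,
          if (Y i ω, Y (s - i) ω) ∈ A i (s - i) then (1 : ℝ) else 0) := fun s =>
      Real.measurable_exp.comp (Finset.measurable_fun_sum _ fun i _ =>
        Measurable.ite (((hY i).prodMk (hY (s - i))) (hA _ _)) measurable_const measurable_const)
    refine (lintegral_mono fun ω => ENNReal.ofReal_le_ofReal (hj ω)).trans ?_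
    simp_rw [ENNReal.ofReal_sum_of_nonneg fun (i : Fin n) _ =>
      mul_nonneg (by positivity : 0 ≤ 1 / (n : ℝ)) (Real.exp_pos _).le,
      ENNReal.ofReal_mul (by positivity : 0 ≤ 1 / (n : ℝ))]
    rw [lintegral_finsetSum _ fun s _ => (hm s).ennreal_ofReal.const_mul _]
    calc _ ≤ ∑ s : Fin n, ENNReal.ofReal (1 / n) * ENNReal.ofReal (Real.exp (2 * n * p)) := by
          refine Finset.sum_le_sum fun s _ => ?_
          rw [lintegral_const_mul _ (hm s).ennreal_ofReal]
          gcongr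
          convert! lintegral_exp_matching_le hY hind hA hp hp0 s using 10
      _ = _ := by
          rw [Finset.sum_const, Finset.card_univ, Fintype.card_fin, nsmul_eq_mul, ← mul_assoc,
            ← ENNReal.ofReal_natCast n, ← ENNReal.ofReal_mul hn.le, mul_one_div_cancel hn.ne']
          simp
  refine le_trans (measure_mono fun ω hω => ?_)
    (measure_le_of_lintegral_exp_le ((measurable_pairCount hY hA).div_const _) h1 (a := n * x))
  simp only [Set.mem_ofPred_eq] at hω ⊢
  rw [le_div_iff₀ hn]
  nlinarith

end Matchings

/-! ### Law of the inliers given their labels. -/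

section Conditioning

theorem setOf_label_eq_iInter {Ω : Type*} {n r : ℕ} (φ : Fin n → Ω → Fin r) (lab : Fin n → Fin r) :
    {ω | ∀ i, φ i ω = lab i} = ⋂ i, φ i ⁻¹' {lab i} := by
  ext ω
  simp

variable {Ω : Type*} [MeasurableSpace Ω] {P : Measure Ω} {d r n m : ℕ} {w : Fin r → ℝ}
  {D : Fin r → Measure (EuclideanSpace ℝ (Fin d))} {φ : Fin n → Ω → Fin r}
  {y : Fin n ⊕ Fin m → Ω → EuclideanSpace ℝ (Fin d)}

theorem IsMixtureSample.indep_point_label (h : IsMixtureSample P w D φ y) :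
    iIndepFun (fun (i : Fin n) ω => (y (Sum.inl i) ω, φ i ω)) P :=
  h.indep.comp (fun _ => Prod.swap) fun _ => measurable_swap

theorem measure_label_ne_zero {lab : Fin n → Fin r} (hlab : P {ω | ∀ i, φ i ω = lab i} ≠ 0)
    (i : Fin n) : P (φ i ⁻¹' {lab i}) ≠ 0 := fun h0 =>
  hlab (measure_mono_null (fun _ hω => hω i) h0)

theorem IsMixtureSample.iIndepFun_cond (h : IsMixtureSample P w D φ y) {lab : Fin n → Fin r}
    (hlab : P {ω | ∀ i, φ i ω = lab i} ≠ 0) :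
    iIndepFun (fun i => y (Sum.inl i)) (cond P {ω | ∀ i, φ i ω = lab i}) := by
  rw [setOf_label_eq_iInter]
  exact iIndepFun.cond h.measurable_label h.indep_point_label (measure_label_ne_zero hlab)
    fun i => measurableSet_singleton _

/-- By independence, conditioning on all labels acts on point `i` as conditioning on its own label;
the weight then cancels, being nonzero because the label event has positive probability. -/
theorem IsMixtureSample.map_cond [∀ k, IsProbabilityMeasure (D k)]
    (h : IsMixtureSample P w D φ y) {lab : Fin n → Fin r}
    (hlab : P {ω | ∀ i, φ i ω = lab i} ≠ 0) (i : Fin n) :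
    (cond P {ω | ∀ i, φ i ω = lab i}).map (y (Sum.inl i)) = D (lab i) := by
  ext B hB
  rw [Measure.map_apply (h.measurable_point _) hB, setOf_label_eq_iInter]
  have h1 := cond_iInter (s := {i}) (f := fun i => y (Sum.inl i) ⁻¹' B) h.measurable_label
    h.indep_point_label (fun j _ => ⟨B, hB, rfl⟩)
    (fun j _ => measure_label_ne_zero hlab j) fun i => measurableSet_singleton _
  have hw : P (φ i ⁻¹' {lab i}) = ENNReal.ofReal (w (lab i)) := by
    have h0 := h.law i (lab i) Set.univ MeasurableSet.univ
    simp only [Set.mem_univ, and_true, measure_univ, mul_one] at h0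
    exact h0
  simp only [Finset.mem_singleton, Set.iInter_iInter_eq_left, Finset.prod_singleton] at h1
  rw [h1, cond_apply (h.measurable_label i (measurableSet_singleton _)), hw]
  have h2 : P (φ i ⁻¹' {lab i} ∩ y (Sum.inl i) ⁻¹' B) = ENNReal.ofReal (w (lab i)) * D (lab i) B :=
    h.law i (lab i) B hB
  rw [h2, ← mul_assoc, ENNReal.inv_mul_cancel (hw ▸ measure_label_ne_zero hlab i)
    ENNReal.ofReal_ne_top, one_mul]

theorem IsSubgaussianVector.lintegral_exp_le {D : Measure (EuclideanSpace ℝ (Fin d))}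
    {c : EuclideanSpace ℝ (Fin d)} {ψ τ : ℝ} (h : IsSubgaussianVector D c ψ) (hψ : 0 ≤ ψ)
    (hτ : ψ ≤ τ) (ν : EuclideanSpace ℝ (Fin d)) :
    ∫⁻ x, ENNReal.ofReal (Real.exp (inner ℝ ν (x - c))) ∂D ≤
      ENNReal.ofReal (Real.exp (τ ^ 2 * ‖ν‖ ^ 2 / 2)) := by
  rw [← ofReal_integral_eq_lintegral_ofReal (h.integrable_exp ν)
    (Filter.Eventually.of_forall fun _ => (Real.exp_pos _).le)]
  refine ENNReal.ofReal_le_ofReal ((h.mgf_le ν).trans (Real.exp_le_exp.2 ?_))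
  gcongr

end Conditioning

/-! ### Probability that a pair of inliers is bad. -/

section PairTails

variable {Ω : Type*} [MeasurableSpace Ω] {Q : Measure Ω} {d : ℕ}

theorem lintegral_exp_inner_sub_le {Y Y' : Ω → EuclideanSpace ℝ (Fin d)} (hY : Measurable Y)
    (hY' : Measurable Y') (hind : IndepFun Y Y' Q) {c c' : EuclideanSpace ℝ (Fin d)} {τ : ℝ}
    (h : ∀ ν, ∫⁻ ω, ENNReal.ofReal (Real.exp (inner ℝ ν (Y ω - c))) ∂Q ≤
      ENNReal.ofReal (Real.exp (τ ^ 2 * ‖ν‖ ^ 2 / 2)))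
    (h' : ∀ ν, ∫⁻ ω, ENNReal.ofReal (Real.exp (inner ℝ ν (Y' ω - c'))) ∂Q ≤
      ENNReal.ofReal (Real.exp (τ ^ 2 * ‖ν‖ ^ 2 / 2)))
    (ν : EuclideanSpace ℝ (Fin d)) :
    ∫⁻ ω, ENNReal.ofReal (Real.exp (inner ℝ ν ((Y ω - c) - (Y' ω - c')))) ∂Q ≤
      ENNReal.ofReal (Real.exp (2 * τ ^ 2 * ‖ν‖ ^ 2 / 2)) := by
  have hsplit : ∀ ω, ENNReal.ofReal (Real.exp (inner ℝ ν ((Y ω - c) - (Y' ω - c')))) =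
      ENNReal.ofReal (Real.exp (inner ℝ ν (Y ω - c))) *
        ENNReal.ofReal (Real.exp (inner ℝ (-ν) (Y' ω - c'))) := fun ω => by
    rw [← ENNReal.ofReal_mul (Real.exp_pos _).le, ← Real.exp_add, inner_sub_right _ (Y ω - c),
      inner_neg_left, sub_eq_add_neg]
  simp_rw [hsplit]
  have hcomp := hind.comp (φ := fun x => ENNReal.ofReal (Real.exp (inner ℝ ν (x - c))))
    (ψ := fun x => ENNReal.ofReal (Real.exp (inner ℝ (-ν) (x - c')))) (by fun_prop) (by fun_prop)
  simp only [Function.comp_def] at hcomp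
  rw [lintegral_mul_eq_lintegral_mul_lintegral_of_indepFun'' (by fun_prop) (by fun_prop) hcomp]
  refine (mul_le_mul' (h ν) (h' (-ν))).trans (le_of_eq ?_)
  rw [← ENNReal.ofReal_mul (Real.exp_pos _).le, ← Real.exp_add, norm_neg]
  congr 2
  ring

/-- The pairs of points at positions `i`, `j` that are misclassified by the kernel: far apart with
equal labels, or close together with different labels. -/
def badPairs {r n : ℕ} (lab : Fin n → Fin r) (Δ : ℝ) (i j : Fin n) :
    Set (EuclideanSpace ℝ (Fin d) × EuclideanSpace ℝ (Fin d)) :=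
  {z | (lab i = lab j ∧ 5 * Δ ^ 2 / 32 ≤ ‖z.1 - z.2‖ ^ 2) ∨
    (lab i ≠ lab j ∧ ‖z.1 - z.2‖ ^ 2 ≤ Δ ^ 2 / 2)}

theorem measurableSet_badPairs {r n : ℕ} (lab : Fin n → Fin r) (Δ : ℝ) (i j : Fin n) :
    MeasurableSet (badPairs (d := d) lab Δ i j) := by
  refine MeasurableSet.union (MeasurableSet.inter (MeasurableSet.const _) ?_)
    (MeasurableSet.inter (MeasurableSet.const _) ?_)
  · exact measurableSet_le measurable_const ((measurable_fst.sub measurable_snd).norm.pow_const 2)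
  · exact measurableSet_le ((measurable_fst.sub measurable_snd).norm.pow_const 2) measurable_const

theorem inner_le_of_norm_add_sq_le {V : Type*} [NormedAddCommGroup V] [InnerProductSpace ℝ V]
    {u z : V} (h : ‖u + z‖ ^ 2 ≤ ‖u‖ ^ 2 / 2) : inner ℝ u z ≤ -(‖u‖ ^ 2 / 4) := by
  rw [norm_add_sq_real] at h
  nlinarith [sq_nonneg ‖z‖]

theorem minSeparation_le {r : ℕ} (μ : Fin r → EuclideanSpace ℝ (Fin d)) {k l : Fin r}
    (hkl : k ≠ l) : minSeparation μ ≤ ‖μ k - μ l‖ :=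
  ciInf_le (f := fun p : {p : Fin r × Fin r // p.1 ≠ p.2} => ‖μ p.1.1 - μ p.1.2‖)
    (Set.finite_range _).bddBelow ⟨(k, l), hkl⟩

theorem minSeparation_nonneg {r : ℕ} (μ : Fin r → EuclideanSpace ℝ (Fin d)) :
    0 ≤ minSeparation μ :=
  Real.iInf_nonneg fun _ => norm_nonneg _

theorem measure_badPairs_le [SFinite Q] {r n : ℕ} {lab : Fin n → Fin r}
    {μ : Fin r → EuclideanSpace ℝ (Fin d)} {τ : ℝ} (hτ : 0 < τ)
    (hd : 8 * τ * Real.sqrt d ≤ minSeparation μ)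
    {Y : Fin n → Ω → EuclideanSpace ℝ (Fin d)} (hY : ∀ i, Measurable (Y i))
    (hind : iIndepFun Y Q)
    (h : ∀ i ν, ∫⁻ ω, ENNReal.ofReal (Real.exp (inner ℝ ν (Y i ω - μ (lab i)))) ∂Q ≤
      ENNReal.ofReal (Real.exp (τ ^ 2 * ‖ν‖ ^ 2 / 2)))
    {i j : Fin n} (hij : i ≠ j) :
    Q {ω | (Y i ω, Y j ω) ∈ badPairs lab (minSeparation μ) i j} ≤
      ENNReal.ofReal (Real.exp (-(minSeparation μ ^ 2 / (64 * τ ^ 2)))) := by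
  set Δ := minSeparation μ with hΔ
  have hv : 0 < 2 * τ ^ 2 := by positivity
  have hZ : Measurable fun ω => (Y i ω - μ (lab i)) - (Y j ω - μ (lab j)) :=
    ((hY i).sub_const _).sub ((hY j).sub_const _)
  have hmgf := lintegral_exp_inner_sub_le (hY i) (hY j) (hind.indepFun hij) (h i) (h j)
  by_cases hl : lab i = lab j
  -- With `v = 2τ ^ 2` and `s = Δ ^ 2 / (64τ ^ 2)`, the norm threshold `5vs` is exactly `5Δ ^ 2 /
  -- 32`; the separation assumption says `d ≤ s`.
  · have hs : (d : ℝ) ≤ Δ ^ 2 / (64 * τ ^ 2) := by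
      rw [le_div_iff₀ (by positivity)]
      calc (d : ℝ) * (64 * τ ^ 2) = (8 * τ * Real.sqrt d) ^ 2 := by
            rw [mul_pow, Real.sq_sqrt (Nat.cast_nonneg d)]; ring
        _ ≤ Δ ^ 2 := by gcongr
    refine (measure_mono fun ω hω => ?_).trans
      (measure_sq_norm_ge_le_of_subgaussian hZ hv hmgf hs)
    rcases hω with hω | hω
    · simp only [Set.mem_ofPred_eq, hl, sub_sub_sub_cancel_right]
      refine le_trans (le_of_eq ?_) hω.2
      field_simp
      ring
    · exact absurd hl hω.1
  · have hΔu : Δ ≤ ‖μ (lab i) - μ (lab j)‖ := minSeparation_le μ hl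
    have hΔ0 : 0 ≤ Δ := minSeparation_nonneg μ
    refine (measure_mono fun ω hω => ?_).trans
      ((measure_inner_le_le_of_subgaussian hZ hv hmgf (μ (lab i) - μ (lab j))).trans
        (ENNReal.ofReal_le_ofReal (Real.exp_le_exp.2 (neg_le_neg ?_))))
    · rcases hω with hω | hω
      · exact absurd hω.1 hl
      · refine inner_le_of_norm_add_sq_le (le_trans ?_ (hω.2.trans (by gcongr)))
        apply le_of_eq
        congr 2
        abel
    · rw [show 32 * (2 * τ ^ 2) = 64 * τ ^ 2 by ring]
      gcongr

end PairTails

/-! ### Deterministic error bounds for solutions of the linear program. -/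

section Deterministic

/-- The rounded kernel maximises each summand of the objective separately, so equal totals force
equal summands, and `K i j - γ` cancels. -/
theorem IsRobustLPSolution.eq_roundedKernel {ι : Type*} [Fintype ι] {K X : Matrix ι ι ℝ} {γ : ℝ}
    (h : IsRobustLPSolution K γ X) {i j : ι} (hij : K i j ≠ γ) :
    X i j = roundedKernel K γ i j := by
  have hle : ∀ i j, (K i j - γ) * X i j ≤ (K i j - γ) * roundedKernel K γ i j := fun i j => by
    obtain ⟨h0, h1⟩ := h.1 i j
    by_cases hk : γ < K i j
    · simp only [roundedKernel, Matrix.of_apply, hk, if_true]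
      nlinarith
    · simp only [roundedKernel, Matrix.of_apply, hk, if_false]
      nlinarith [not_lt.mp hk]
  have hobj : robustLPObjective K γ X = robustLPObjective K γ (roundedKernel K γ) :=
    le_antisymm (Finset.sum_le_sum fun i _ => Finset.sum_le_sum fun j _ => hle i j)
      (h.2 (roundedKernel_isRobustLPSolution K γ).1)
  have hrow := (Finset.sum_eq_sum_iff_of_le fun i _ =>
    Finset.sum_le_sum fun j _ => hle i j).1 hobj i (Finset.mem_univ i)
  have hentry := (Finset.sum_eq_sum_iff_of_le fun j _ => hle i j).1 hrow j (Finset.mem_univ j)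
  exact mul_left_cancel₀ (sub_ne_zero.2 hij) hentry

variable {r n m : ℕ}

theorem trueClustering_inl_inl (lab : Fin n → Fin r) (i j : Fin n) :
    trueClustering m lab (Sum.inl i) (Sum.inl j) = if lab i = lab j then 1 else 0 := by
  simp [trueClustering, membership, Matrix.mul_apply, eq_comm]

theorem trueClustering_inr_left (lab : Fin n → Fin r) (a : Fin m) (b : Fin n ⊕ Fin m) :
    trueClustering m lab (Sum.inr a) b = 0 := by
  simp [trueClustering, membership, Matrix.mul_apply]

theorem trueClustering_inr_right (lab : Fin n → Fin r) (a : Fin n ⊕ Fin m) (b : Fin m) :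
    trueClustering m lab a (Sum.inr b) = 0 := by
  simp [trueClustering, membership, Matrix.mul_apply]

theorem sum_sum_eq_two_mul_sum_lt [NeZero n] {f : Fin n → Fin n → ℝ}
    (hsymm : ∀ i j, f i j = f j i) (hdiag : ∀ i, f i i = 0) :
    ∑ i, ∑ j, f i j = 2 * ∑ s : Fin n, ∑ i with i < s - i, f i (s - i) := by
  have h1 : ∀ i, ∑ j, f i j = ∑ s, f i (s - i) := fun i =>
    ((Equiv.subRight i).sum_comp (f i)).symm
  simp_rw [h1]
  rw [Finset.sum_comm, Finset.mul_sum]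
  refine Finset.sum_congr rfl fun s _ => ?_
  have h2 : ∀ i, f i (s - i) = (if i < s - i then f i (s - i) else 0) +
      if s - i < i then f i (s - i) else 0 := fun i => by
    rcases lt_trichotomy i (s - i) with h | h | h
    · simp [h, h.le]
    · rw [← h]; simp [hdiag]
    · simp [h, h.le]
  rw [Finset.sum_congr rfl fun i _ => h2 i, Finset.sum_add_distrib, two_mul, Finset.sum_filter]
  congr 1
  -- The reflection `i ↦ s - i` exchanges the two halves.
  rw [← (Equiv.subLeft s).sum_comp]
  simp [hsymm _ (s - _)]

theorem swap_mem_badPairs {d : ℕ} {lab : Fin n → Fin r} {Δ : ℝ} {i j : Fin n}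
    {x x' : EuclideanSpace ℝ (Fin d)} :
    (x, x') ∈ badPairs lab Δ i j ↔ (x', x) ∈ badPairs lab Δ j i := by
  simp only [badPairs, Set.mem_ofPred_eq, norm_sub_rev x x', eq_comm (a := lab i), ne_comm]

/-- Diagonal entries are always correct since the distance is zero; hence only pairs `i < j` need to
be counted. -/
theorem IsRobustLPSolution.eq_trueClustering {d : ℕ} {lab : Fin n → Fin r} {Δ θ γ : ℝ}
    (hθ : 0 < θ) (hout : tauOut Δ θ < γ) (hin : γ < tauIn Δ θ)
    {x : Fin n ⊕ Fin m → EuclideanSpace ℝ (Fin d)} {X : Matrix (Fin n ⊕ Fin m) (Fin n ⊕ Fin m) ℝ}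
    (hX : IsRobustLPSolution (kernelMatrix θ x) γ X) {i j : Fin n}
    (hij : i = j ∨ (x (Sum.inl i), x (Sum.inl j)) ∉ badPairs lab Δ i j) :
    X (Sum.inl i) (Sum.inl j) = trueClustering m lab (Sum.inl i) (Sum.inl j) := by
  have hgt : lab i = lab j → γ < kernelMatrix θ x (Sum.inl i) (Sum.inl j) := fun hl => by
    refine hin.trans_le ?_
    simp only [tauIn, kernelMatrix, Matrix.of_apply, Real.exp_le_exp, neg_le_neg_iff]
    have hn : ‖x (Sum.inl i) - x (Sum.inl j)‖ ^ 2 ≤ 5 * Δ ^ 2 / 32 := by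
      rcases hij with rfl | hij
      · simp; positivity
      · simp only [badPairs, Set.mem_ofPred_eq, not_or, not_and, not_le] at hij
        exact (hij.1 hl).le
    rw [← div_div]
    gcongr
  have hlt : lab i ≠ lab j → kernelMatrix θ x (Sum.inl i) (Sum.inl j) < γ := fun hl => by
    refine lt_of_le_of_lt ?_ hout
    simp only [tauOut, kernelMatrix, Matrix.of_apply, Real.exp_le_exp, neg_le_neg_iff]
    have hn : Δ ^ 2 / 2 ≤ ‖x (Sum.inl i) - x (Sum.inl j)‖ ^ 2 := by
      rcases hij with rfl | hij
      · exact absurd rfl hl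
      · simp only [badPairs, Set.mem_ofPred_eq, not_or, not_and, not_le] at hij
        exact (hij.2 hl).le
    rw [← div_div]
    gcongr
  rw [trueClustering_inl_inl]
  by_cases hl : lab i = lab j
  · rw [hX.eq_roundedKernel (hgt hl).ne']
    simp [roundedKernel, hgt hl, hl]
  · rw [hX.eq_roundedKernel (hlt hl).ne]
    simp [roundedKernel, (hlt hl).le, hl]

theorem abs_sub_trueClustering_le_one {lab : Fin n → Fin r}
    {X : Matrix (Fin n ⊕ Fin m) (Fin n ⊕ Fin m) ℝ} (hX : X ∈ robustLPFeasible _)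
    (a b : Fin n ⊕ Fin m) : |X a b - trueClustering m lab a b| ≤ 1 := by
  obtain ⟨h0, h1⟩ := hX a b
  have h2 : trueClustering m lab a b = 0 ∨ trueClustering m lab a b = 1 := by
    rcases a with i | i <;> rcases b with j | j
    · rw [trueClustering_inl_inl]
      split_ifs <;> simp
    all_goals simp [trueClustering_inr_left, trueClustering_inr_right]
  rw [abs_le]
  rcases h2 with h2 | h2 <;> rw [h2] <;> constructor <;> linarith

theorem l1Norm_inlierPart_sub_le [NeZero n] {d : ℕ} {lab : Fin n → Fin r} {Δ θ γ : ℝ}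
    (hθ : 0 < θ) (hout : tauOut Δ θ < γ) (hin : γ < tauIn Δ θ)
    {x : Fin n ⊕ Fin m → EuclideanSpace ℝ (Fin d)} {X : Matrix (Fin n ⊕ Fin m) (Fin n ⊕ Fin m) ℝ}
    (hX : IsRobustLPSolution (kernelMatrix θ x) γ X) :
    l1Norm (inlierPart X - inlierPart (trueClustering m lab)) ≤
      2 * pairCount (badPairs lab Δ) fun i => x (Sum.inl i) := by
  classical
  have h := sum_sum_eq_two_mul_sum_lt (f := fun i j : Fin n =>
      if i ≠ j ∧ (x (Sum.inl i), x (Sum.inl j)) ∈ badPairs lab Δ i j then (1 : ℝ) else 0)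
    (fun i j => by simp only [swap_mem_badPairs (i := i), ne_comm]) (fun i => by simp)
  have h' : pairCount (badPairs lab Δ) (fun i => x (Sum.inl i)) =
      ∑ s : Fin n, ∑ i with i < s - i, if i ≠ s - i ∧
        (x (Sum.inl i), x (Sum.inl (s - i))) ∈ badPairs lab Δ i (s - i) then (1 : ℝ) else 0 := by
    unfold pairCount
    refine Finset.sum_congr rfl fun s _ => Finset.sum_congr (by congr) fun i hi => ?_
    have hne : i ≠ s - i := ((Finset.mem_filter.1 hi).2).ne
    simp [hne]
  rw [h', ← h]
  refine Finset.sum_le_sum fun i _ => Finset.sum_le_sum fun j _ => ?_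
  simp only [Matrix.sub_apply, inlierPart, Matrix.submatrix_apply]
  split_ifs with hb
  · exact abs_sub_trueClustering_le_one hX.1 _ _
  · rw [hX.eq_trueClustering (lab := lab) hθ hout hin (by tauto)]
    simp

theorem l1Norm_sub_trueClustering_le {lab : Fin n → Fin r}
    {X : Matrix (Fin n ⊕ Fin m) (Fin n ⊕ Fin m) ℝ} (hX : X ∈ robustLPFeasible _) :
    l1Norm (X - trueClustering m lab) ≤
      l1Norm (inlierPart X - inlierPart (trueClustering m lab)) + 2 * (n * m) + m ^ 2 := by
  have h1 := abs_sub_trueClustering_le_one (lab := lab) hX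
  have h12 : ∑ i : Fin n, ∑ j : Fin m,
      |X (Sum.inl i) (Sum.inr j) - trueClustering m lab (Sum.inl i) (Sum.inr j)| ≤ n * m := by
    refine (Finset.sum_le_sum fun i _ => Finset.sum_le_sum fun j _ => h1 _ _).trans ?_
    simp
  have h21 : ∑ i : Fin m, ∑ j : Fin n,
      |X (Sum.inr i) (Sum.inl j) - trueClustering m lab (Sum.inr i) (Sum.inl j)| ≤ m * n := by
    refine (Finset.sum_le_sum fun i _ => Finset.sum_le_sum fun j _ => h1 _ _).trans ?_
    simp
  have h22 : ∑ i : Fin m, ∑ j : Fin m,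
      |X (Sum.inr i) (Sum.inr j) - trueClustering m lab (Sum.inr i) (Sum.inr j)| ≤ m * m := by
    refine (Finset.sum_le_sum fun i _ => Finset.sum_le_sum fun j _ => h1 _ _).trans ?_
    simp
  simp only [l1Norm, Fintype.sum_sum_type, Finset.sum_add_distrib, Matrix.sub_apply, inlierPart,
    Matrix.submatrix_apply]
  linarith

/-- The norm is the sum of the squared cluster sizes, and the sizes sum to `n`; Cauchy-Schwarz over
the `r` clusters concludes. -/
theorem sq_le_mul_l1Norm_trueClustering (lab : Fin n → Fin r) :
    (n : ℝ) ^ 2 ≤ r * l1Norm (trueClustering m lab) := by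
  have h1 : l1Norm (trueClustering m lab) = ∑ k, (clusterSize lab k : ℝ) ^ 2 := by
    have h2 : ∀ i j : Fin n, |if lab i = lab j then (1 : ℝ) else 0| =
        ∑ k, (if lab i = k then (1 : ℝ) else 0) * if lab j = k then 1 else 0 := fun i j => by
      by_cases h : lab i = lab j <;> simp [h, eq_comm]
    simp only [l1Norm, Fintype.sum_sum_type, trueClustering_inl_inl, trueClustering_inr_left,
      trueClustering_inr_right, abs_zero, Finset.sum_const_zero, add_zero, h2]
    simp_rw [Finset.sum_comm (s := Finset.univ (α := Fin n)) (t := Finset.univ (α := Fin r))]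
    refine Finset.sum_congr rfl fun k _ => ?_
    rw [← Finset.sum_mul_sum, clusterSize, ← sq]
    simp
  have h3 : (n : ℝ) = ∑ k, (clusterSize lab k : ℝ) := by
    have := Finset.card_eq_sum_card_fiberwise (f := lab) (s := Finset.univ) (t := Finset.univ)
      (by simp)
    rw [Finset.card_univ, Fintype.card_fin] at this
    exact_mod_cast this
  rw [h1, h3]
  simpa using sq_sum_le_card_mul_sum_sq (s := Finset.univ) (f := fun k => (clusterSize lab k : ℝ))

theorem minClusterSize_le [NeZero r] (lab : Fin n → Fin r) : minClusterSize lab ≤ n :=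
  (ciInf_le (OrderBot.bddBelow _) 0).trans ((Finset.card_filter_le _ _).trans (by simp))

end Deterministic

/-! ### Choice of constants and assembly. -/

theorem le_sigmaMax {r : ℕ} (σ : Fin r → ℝ) (k : Fin r) : σ k ≤ sigmaMax σ :=
  le_ciSup (Set.finite_range σ).bddAbove k

/-- At `Δ = 0` both thresholds equal `1`, so a strict gap forces `Δ > 0`. -/
theorem pos_of_tauOut_lt_tauIn {Δ κ θ : ℝ} (hΔ : 0 ≤ Δ) (hκ : 0 < κ) (hθ : κ * Δ ≤ θ)
    (h : tauOut Δ θ < tauIn Δ θ) : 0 < θ := by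
  refine lt_of_lt_of_le (mul_pos hκ (lt_of_le_of_ne hΔ fun h0 => ?_)) hθ
  simp [← h0, tauOut, tauIn] at h

/-- At level `3 * max p (log N / N)` the term `2np` absorbs two of the three maxima; the third is at
least `log N / n`, because `N ≤ n`. -/
theorem measure_pairCount_ge_le_inv {Ω E : Type*} [MeasurableSpace Ω] [MeasurableSpace E]
    {Q : Measure Ω} {n : ℕ} [NeZero n] {Y : Fin n → Ω → E} (hY : ∀ i, Measurable (Y i))
    (hind : iIndepFun Y Q) {A : Fin n → Fin n → Set (E × E)} (hA : ∀ i j, MeasurableSet (A i j))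
    {p : ℝ} (hp : ∀ i j, i ≠ j → Q {ω | (Y i ω, Y j ω) ∈ A i j} ≤ ENNReal.ofReal p) (hp0 : 0 ≤ p)
    {N : ℕ} (hN : 0 < N) (hNn : N ≤ n) :
    Q {ω | (n : ℝ) ^ 2 * (3 * max p (Real.log N / N)) ≤ pairCount A fun i => Y i ω} ≤
      ENNReal.ofReal (1 / N) := by
  refine (measure_pairCount_ge_le hY hind hA hp hp0 _).trans (ENNReal.ofReal_le_ofReal ?_)
  have hN' : (0 : ℝ) < N := by exact_mod_cast hN
  have hNn' : (N : ℝ) ≤ n := by exact_mod_cast hNn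
  rw [one_div, ← Real.exp_log (inv_pos.2 hN'), Real.log_inv, Real.exp_le_exp]
  have hL : 0 ≤ Real.log N / N := div_nonneg (Real.log_natCast_nonneg N) hN'.le
  have h1 : Real.log N ≤ n * (Real.log N / N) := by
    calc Real.log N = N * (Real.log N / N) := by field_simp
      _ ≤ _ := by gcongr
  have h2 : n * (Real.log N / N) ≤ n * max p (Real.log N / N) := by
    gcongr; exact le_max_right _ _
  have h3 : n * p ≤ n * max p (Real.log N / N) := by
    gcongr; exact le_max_left _ _
  nlinarith

end RobustClustering

theorem mainTheorem1 :
    ∃ C C' C'' : ℝ, 0 < C ∧ 0 < C' ∧ 0 < C'' ∧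
      ∀ {Ω : Type*} [MeasurableSpace Ω] (P : MeasureTheory.Measure Ω)
        [MeasureTheory.IsProbabilityMeasure P]
        (d r n m : ℕ) (_ : 2 ≤ r)
        (w : Fin r → ℝ)
        (D : Fin r → MeasureTheory.Measure (EuclideanSpace ℝ (Fin d)))
        [∀ k, MeasureTheory.IsProbabilityMeasure (D k)]
        (μ : Fin r → EuclideanSpace ℝ (Fin d)) (σ : Fin r → ℝ)
        (_ : ∀ k, 0 < σ k)
        (_ : ∀ k, RobustClustering.IsSubgaussianVector (D k) (μ k) (σ k))
        (φ : Fin n → Ω → Fin r) (y : Fin n ⊕ Fin m → Ω → EuclideanSpace ℝ (Fin d))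
        (_ : RobustClustering.IsMixtureSample P w D φ y)
        (Δ σmax : ℝ) (_ : Δ = RobustClustering.minSeparation μ)
        (_ : σmax = RobustClustering.sigmaMax σ)
        (κ₁ κ₂ θ γ : ℝ) (_ : 0 < κ₁) (_ : κ₁ * Δ ≤ θ) (_ : θ ≤ κ₂ * Δ)
        (_ : RobustClustering.tauOut Δ θ < γ) (_ : γ < RobustClustering.tauIn Δ θ)
        (_ : 8 * σmax * Real.sqrt d ≤ Δ)
        (lab : Fin n → Fin r) (_ : P {ω | ∀ i, φ i ω = lab i} ≠ 0)
        (nmin : ℕ) (_ : nmin = RobustClustering.minClusterSize lab) (_ : r < nmin),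
        1 - 2 * (r : ℝ) / (nmin : ℝ) ≤
          (ProbabilityTheory.cond P {ω | ∀ i, φ i ω = lab i}).real
            {ω | ∀ X : Matrix (Fin n ⊕ Fin m) (Fin n ⊕ Fin m) ℝ,
              RobustClustering.IsRobustLPSolution
                  (RobustClustering.kernelMatrix θ (fun a => y a ω)) γ X →
                RobustClustering.l1Norm
                    (RobustClustering.inlierPart X -
                      RobustClustering.inlierPart (RobustClustering.trueClustering m lab)) ≤
                  C * (n : ℝ) ^ 2 *
                    max (Real.exp (-(Δ ^ 2 / (64 * σmax ^ 2))))
                      (Real.log (nmin : ℝ) / (nmin : ℝ)) ∧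
                (m < n →
                  RobustClustering.l1Norm (X - RobustClustering.trueClustering m lab) /
                      RobustClustering.l1Norm (RobustClustering.trueClustering m lab) ≤
                    C' * (r : ℝ) * Real.exp (-(Δ ^ 2 / (64 * σmax ^ 2))) +
                      C'' * (r : ℝ) *
                        max (Real.log (nmin : ℝ) / (nmin : ℝ)) ((m : ℝ) / (n : ℝ)))} := by
  -- The inlier constant is `6 = 2 * 3`: two ordered entries per pair, times the level `3`. The
  -- outlier terms satisfy `2nm + m ^ 2 ≤ 3nm` for `m < n`, which raises the last constant to `9 = 6
  -- + 3`.
  refine ⟨6, 6, 9, by norm_num, by norm_num, by norm_num, ?_⟩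
  intro Ω _ P _ d r n m hr w D _ μ σ hσ hD φ y hmix Δ σmax hΔ hσmax κ₁ κ₂ θ γ hκ hθ₁ hθ₂ hout hin
    hsep lab hlab nmin hnmin hrn
  open RobustClustering in
  have : NeZero r := ⟨by omega⟩
  have hNn : nmin ≤ n := hnmin ▸ minClusterSize_le lab
  have hN : 0 < nmin := by omega
  have : NeZero n := ⟨by omega⟩
  have hN' : (0 : ℝ) < nmin := by exact_mod_cast hN
  have hn' : (0 : ℝ) < n := by exact_mod_cast hN.trans_le hNn
  have hr' : (0 : ℝ) < r := by positivity
  have hθ : 0 < θ := pos_of_tauOut_lt_tauIn (hΔ ▸ minSeparation_nonneg μ) hκ hθ₁ (hout.trans hin)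
  have hσmax0 : 0 < σmax := (hσ 0).trans_le (hσmax ▸ le_sigmaMax σ 0)
  have := cond_isProbabilityMeasure hlab
  set Q := ProbabilityTheory.cond P {ω | ∀ i, φ i ω = lab i} with hQ
  set p := Real.exp (-(Δ ^ 2 / (64 * σmax ^ 2))) with hp
  have hp0 : 0 ≤ p := (Real.exp_pos _).le
  set L := Real.log nmin / nmin with hL
  have hL0 : 0 ≤ L := div_nonneg (Real.log_natCast_nonneg _) hN'.le
  have hY : ∀ i, Measurable (y (Sum.inl i)) := fun i => hmix.measurable_point _
  have hind : ProbabilityTheory.iIndepFun (fun i => y (Sum.inl i)) Q := hmix.iIndepFun_cond hlab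
  have hmgf : ∀ i ν, ∫⁻ ω, ENNReal.ofReal (Real.exp
      (inner ℝ ν (y (Sum.inl i) ω - μ (lab i)))) ∂Q ≤
      ENNReal.ofReal (Real.exp (σmax ^ 2 * ‖ν‖ ^ 2 / 2)) := fun i ν => by
    have h := (hD (lab i)).lintegral_exp_le (hσ _).le (hσmax ▸ le_sigmaMax σ (lab i)) ν
    rwa [← hmix.map_cond hlab i, MeasureTheory.lintegral_map (by fun_prop) (hY i)] at h
  have hbad : ∀ i j, i ≠ j → Q {ω | (y (Sum.inl i) ω, y (Sum.inl j) ω) ∈ badPairs lab Δ i j} ≤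
      ENNReal.ofReal p := fun i j hij => by
    rw [hp, hΔ]
    exact measure_badPairs_le hσmax0 (hΔ ▸ hsep) hY hind hmgf hij
  have htail := measure_pairCount_ge_le_inv hY hind (measurableSet_badPairs lab Δ) hbad hp0 hN hNn
  have hmeas := measurable_pairCount hY (measurableSet_badPairs lab Δ)
  set B := {ω | (n : ℝ) ^ 2 * (3 * max p L) ≤ pairCount (badPairs lab Δ) fun i => y (Sum.inl i) ω}
    with hB
  have hBm : MeasurableSet B := measurableSet_le measurable_const hmeas
  have hBreal : Q.real B ≤ 1 / nmin := ENNReal.toReal_le_of_le_ofReal (by positivity) htail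
  have hbound : 1 - 2 * (r : ℝ) / nmin ≤ Q.real Bᶜ := by
    rw [MeasureTheory.probReal_compl_eq_one_sub hBm]
    have h1 : (1 : ℝ) ≤ r := by exact_mod_cast (by omega : 1 ≤ r)
    -- The failure probability obtained is `1 / nmin`, smaller than required.
    have : 1 / (nmin : ℝ) ≤ 2 * r / nmin := by gcongr; linarith
    linarith
  -- Only monotonicity of the measure is used, so the event quantified over all `X` need not be
  -- shown measurable.
  refine hbound.trans (MeasureTheory.measureReal_mono fun ω hω X hX => ?_)
  have hin1 : l1Norm (inlierPart X - inlierPart (trueClustering m lab)) ≤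
      6 * (n : ℝ) ^ 2 * max p L := by
    have h1 := l1Norm_inlierPart_sub_le (lab := lab) hθ hout hin hX
    have h2 : pairCount (badPairs lab Δ) (fun i => y (Sum.inl i) ω) <
      (n : ℝ) ^ 2 * (3 * max p L) := not_le.1 hω
    linarith
  refine ⟨hin1, fun hmn => ?_⟩
  have hmn' : (m : ℝ) ≤ n := by exact_mod_cast hmn.le
  have hX0 := sq_le_mul_l1Norm_trueClustering (m := m) lab
  have hX0pos : 0 < l1Norm (trueClustering m lab) := by
    by_contra hcon
    nlinarith [sq_pos_of_pos hn']
  have htot := l1Norm_sub_trueClustering_le (lab := lab) hX.1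
  rw [div_le_iff₀ hX0pos]
  set M := max L ((m : ℝ) / n) with hM
  have hmaxpL : max p L ≤ p + M := by
    have : L ≤ M := le_max_left _ _
    exact max_le (by linarith) (by linarith)
  have hmM : (m : ℝ) ≤ n * M := by
    have : (m : ℝ) / n ≤ M := le_max_right _ _
    rwa [div_le_iff₀' hn'] at this
  have hM0 : 0 ≤ M := hL0.trans (le_max_left _ _)
  have hm0 : (0 : ℝ) ≤ m := Nat.cast_nonneg m
  calc l1Norm (X - trueClustering m lab)
      ≤ 6 * (n : ℝ) ^ 2 * (p + M) + 3 * (n * (n * M)) := by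
        have h1 : 6 * (n : ℝ) ^ 2 * max p L ≤ 6 * (n : ℝ) ^ 2 * (p + M) := by gcongr
        have h2 : (m : ℝ) ^ 2 ≤ n * (n * M) := by
          rw [sq]; exact mul_le_mul hmn' hmM hm0 hn'.le
        have h3 : (n : ℝ) * m ≤ n * (n * M) := by gcongr
        linarith
    _ = (n : ℝ) ^ 2 * (6 * p + 9 * M) := by ring
    _ ≤ (r * l1Norm (trueClustering m lab)) * (6 * p + 9 * M) := by gcongr
    _ = _ := by ring
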